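/- Let $n \ge 0$ be an integer and let $T_n$ be a polynomial of degree $n$ with complex coefficients. Put $T_n^{-1}([-1,1]) := \{z \in \mathbb{C} : T_n(z) \in [-1,1]\}$, where $[-1,1]$ is the real interval regarded as a subset of $\mathbb{C}$. Then $T_n^{-1}([-1,1])$ is connected (and nonempty) if and only if every zero $z \in \mathbb{C}$ of the derivative $T_n'$ lies in $T_n^{-1}([-1,1])$. -/

import Mathlib

/-!
Let `g` be the Green function of `ℂ ∖ [-1, 1]`, normalised by `g (cosh ζ) = |re ζ|`.

If `T⁻¹[-1, 1]` is connected, so is every sublevel set `G` of `g ∘ T`. It contains all zeros of `T`,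
so `(z - b) / (z - a)` has a continuous logarithm outside `G` for any two zeros `a`, `b`, and hence
`T = S ^ n` there. By properness `S` maps the superlevel set `T⁻¹ E` onto the set of all `n`-th
roots of points of `E`. Each `w ∈ E` therefore has `n` distinct preimages under `T` and is not a
critical value.

Conversely, if all critical values lie in `[-1, 1]`, then `cosh` on the right half-plane lifts
through `T`. As `T⁻¹ (ℂ ∖ [-1, 1])` is connected and two lifts whose images meet differ by a
translation by a multiple of `2πi`, a single lift is onto. Hence each `{0 < g ∘ T < c}` is the image
of a strip, the sets `{g ∘ T < c}` are connected, and they shrink to `T⁻¹[-1, 1]`.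
-/

open Polynomial Filter Topology Set

/-! ### Proper maps and connectedness -/

section ProperMaps

variable {X Y Z : Type*} [TopologicalSpace X] [TopologicalSpace Y] [TopologicalSpace Z]

/- The image is relatively closed because, by properness of `T`, points of `U` whose `f`-images
converge in `p ⁻¹' E` accumulate at a point over `E`. -/
theorem image_eq_preimage_of_isProperMap [T2Space Z] {T : X → Y} (hT : IsProperMap T)
    {p : Z → Y} (hp : Continuous p) {E : Set Y} (hE : IsPreconnected (p ⁻¹' E))
    {U : Set X} (hU : U.Nonempty) (hUE : U ⊆ T ⁻¹' E) (hUcl : closure U ∩ T ⁻¹' E ⊆ U)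
    {f : X → Z} (hf : ∀ x ∈ U, ContinuousAt f x) (hfT : ∀ x ∈ U, p (f x) = T x)
    (hfU : IsOpen (f '' U)) : f '' U = p ⁻¹' E := by
  have hsub : f '' U ⊆ p ⁻¹' E := by
    rintro _ ⟨x, hx, rfl⟩
    simpa only [mem_preimage, hfT x hx] using hUE hx
  refine hsub.antisymm (hE.subset_of_closure_inter_subset hfU ?_ ?_)
  · obtain ⟨x, hx⟩ := hU
    exact ⟨f x, hsub (mem_image_of_mem f hx), mem_image_of_mem f hx⟩
  rintro y ⟨hy, hyE⟩
  set ℱ : Filter X := comap f (𝓝 y) ⊓ 𝓟 U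
  have hℱ : ℱ.NeBot := (nhds_basis_opens y).comap f |>.inf_principal_neBot_iff.2 fun {V} hV => by
    obtain ⟨_, hxV, x, hx, rfl⟩ := mem_closure_iff.1 hy V hV.2 hV.1
    exact ⟨x, hxV, hx⟩
  have hUℱ : U ∈ ℱ := mem_inf_of_right (mem_principal_self U)
  have hfℱ : Tendsto f ℱ (𝓝 y) := tendsto_comap.mono_left inf_le_left
  have hTℱ : Tendsto T ℱ (𝓝 (p y)) :=
    ((hp.tendsto y).comp hfℱ).congr' (eventually_of_mem hUℱ hfT)
  obtain ⟨x, hTx, hx⟩ := hT.clusterPt_of_mapClusterPt hTℱ.mapClusterPt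
  have hxU : x ∈ U := hUcl
    ⟨mem_closure_iff_clusterPt.2 (hx.mono (le_principal_iff.2 hUℱ)), by rwa [mem_preimage, hTx]⟩
  have hxℱ : (𝓝 x ⊓ ℱ).NeBot := hx
  exact ⟨x, hxU, tendsto_nhds_unique ((hf x hxU).mono_left inf_le_left)
    (hfℱ.mono_left inf_le_right)⟩

theorem image_inter_eq_of_isProperMap [T2Space Y] {T : X → Y} (hT : IsProperMap T)
    (hTo : IsOpenMap T) {E : Set Y} (hEo : IsOpen E) (hE : IsPreconnected E) {u v : Set X}
    (hu : IsOpen u) (hv : IsOpen v) (huv : T ⁻¹' E ⊆ u ∪ v) (hdisj : T ⁻¹' E ∩ (u ∩ v) = ∅)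
    (hne : (T ⁻¹' E ∩ v).Nonempty) : T '' (T ⁻¹' E ∩ v) = E := by
  refine image_eq_preimage_of_isProperMap hT continuous_id hE hne inter_subset_left ?_
    (fun x _ => hT.continuous.continuousAt) (fun _ _ => rfl)
    (hTo _ ((hEo.preimage hT.continuous).inter hv))
  rintro z ⟨hzcl, hzE⟩
  refine ⟨hzE, (huv hzE).resolve_left fun hzu => ?_⟩
  obtain ⟨y, hyu, hyE, hyv⟩ := mem_closure_iff.1 hzcl u hu hzu
  exact hdisj.subset ⟨hyE, hyu, hyv⟩

/- Each piece of a separation of `T ⁻¹' E` is mapped onto `E`, so none of them can avoid `B`. -/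
theorem isPreconnected_preimage_of_isProperMap [T2Space Y] {T : X → Y} (hT : IsProperMap T)
    (hTo : IsOpenMap T) {E : Set Y} (hEo : IsOpen E) (hE : IsPreconnected E) {B : Set X}
    (hB : IsPreconnected B) (hBE : B ⊆ T ⁻¹' E) (hEB : ¬ E ⊆ T '' Bᶜ) :
    IsPreconnected (T ⁻¹' E) := by
  have hcontains : ∀ u v : Set X, IsOpen u → IsOpen v → T ⁻¹' E ⊆ u ∪ v →
      T ⁻¹' E ∩ (u ∩ v) = ∅ → B ⊆ u → T ⁻¹' E ⊆ u := by
    intro u v hu hv huv hdisj hBu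
    by_contra hsub
    obtain ⟨x, hxE, hxu⟩ := not_subset.1 hsub
    refine hEB ?_
    rw [← image_inter_eq_of_isProperMap hT hTo hEo hE hu hv huv hdisj
      ⟨x, hxE, (huv hxE).resolve_left hxu⟩]
    exact image_mono fun z hz hzB => hdisj.subset ⟨hz.1, hBu hzB, hz.2⟩
  refine isPreconnected_iff_subset_of_disjoint.2 fun u v hu hv huv hdisj => ?_
  have hBdisj : B ∩ (u ∩ v) = ∅ := subset_empty_iff.1 fun x hx => hdisj.subset ⟨hBE hx.1, hx.2⟩
  rcases isPreconnected_iff_subset_of_disjoint.1 hB u v hu hv (hBE.trans huv) hBdisj with hBu | hBv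
  · exact Or.inl (hcontains u v hu hv huv hdisj hBu)
  · exact Or.inr (hcontains v u hv hu (union_comm u v ▸ huv) (inter_comm u v ▸ hdisj) hBv)

theorem isPreconnected_fiber_of_isProperMap [T2Space X] {f : X → Y} (hf : IsProperMap f)
    {ι : Sort*} {p : ι → Prop} {s : ι → Set Y} {y : Y} (hs : (𝓝 y).HasBasis p s)
    (h : ∀ i, p i → IsPreconnected (f ⁻¹' s i)) :
    IsPreconnected (f ⁻¹' {y}) := by
  have hK : IsCompact (f ⁻¹' {y}) := hf.isCompact_preimage isCompact_singleton
  refine (isPreconnected_iff_subset_of_fully_disjoint_closed hK.isClosed).2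
    fun u v hu hv huv hdisj => ?_
  obtain ⟨U, V, hU, hV, hKU, hKV, hUV⟩ := SeparatedNhds.of_isCompact_isCompact
    (hK.inter_right hu) (hK.inter_right hv) (hdisj.mono inter_subset_right inter_subset_right)
  have hKUV : U ∪ V ∈ 𝓝ˢ (f ⁻¹' {y}) := (hU.union hV).mem_nhdsSet.2 fun x hx =>
    (huv hx).imp (fun hxu => hKU ⟨hx, hxu⟩) fun hxv => hKV ⟨hx, hxv⟩
  rw [← hf.isClosedMap.comap_nhds_eq hf.continuous] at hKUV
  obtain ⟨i, hi, hsUV⟩ := (hs.comap f).mem_iff.1 hKUV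
  have hKs : f ⁻¹' {y} ⊆ f ⁻¹' s i :=
    preimage_mono (singleton_subset_iff.2 (mem_of_mem_nhds (hs.mem_of_mem hi)))
  refine (isPreconnected_iff_subset_of_disjoint.1 (h i hi) U V hU hV hsUV
    (by rw [hUV.inter_eq, inter_empty])).imp (fun hsU x hx => ?_) fun hsV x hx => ?_
  · exact (huv hx).resolve_right fun hxv => disjoint_left.1 hUV (hsU (hKs hx)) (hKV ⟨hx, hxv⟩)
  · exact (huv hx).resolve_left fun hxu => disjoint_left.1 hUV (hKU ⟨hx, hxu⟩) (hsV (hKs hx))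

theorem isOpen_image_of_comp_eqOn {φ : Y → Z} (hφ : Continuous φ) {f : X → Y} {h : X → Z}
    (hh : IsOpenMap h) {U : Set X} (hU : IsOpen U) (hf : ContinuousOn f U)
    (hφf : EqOn (φ ∘ f) h U) (hinj : ∀ x ∈ U, ∃ V ∈ 𝓝 (f x), InjOn φ V) : IsOpen (f '' U) := by
  rw [isOpen_iff_mem_nhds]
  rintro _ ⟨x, hx, rfl⟩
  obtain ⟨V, hV, hVinj⟩ := hinj x hx
  have hUV : U ∩ f ⁻¹' V ∈ 𝓝 x :=
    inter_mem (hU.mem_nhds hx) ((hf.continuousAt (hU.mem_nhds hx)).preimage_mem_nhds hV)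
  have himage : φ ⁻¹' (h '' (U ∩ f ⁻¹' V)) ∈ 𝓝 (f x) :=
    hφ.continuousAt.preimage_mem_nhds (by
      rw [show φ (f x) = h x from hφf hx]
      exact hh.image_mem_nhds hUV)
  filter_upwards [himage, hV] with y ⟨x', ⟨hx'U, hx'V⟩, hx'⟩ hyV
  exact ⟨x', hx'U, hVinj hx'V hyV ((hφf hx'U).trans hx')⟩

end ProperMaps

/-! ### The Green function of the complement of the segment -/

/-- The Green function of `ℂ ∖ [-1, 1]` with pole at infinity, extended by `0` to `[-1, 1]`; its
level sets are the ellipses with foci `±1`. -/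
noncomputable def segmentGreen (w : ℂ) : ℝ :=
  Real.arcosh ((‖w - 1‖ + ‖w + 1‖) / 2)

theorem one_le_half_norm_sub_one_add_norm_add_one (w : ℂ) : 1 ≤ (‖w - 1‖ + ‖w + 1‖) / 2 := by
  have h : ‖(w + 1) - (w - 1)‖ ≤ ‖w + 1‖ + ‖w - 1‖ := norm_sub_le _ _
  rw [show (w + 1) - (w - 1) = 2 by ring, RCLike.norm_ofNat] at h
  linarith

theorem norm_le_half_norm_sub_one_add_norm_add_one (w : ℂ) :
    ‖w‖ ≤ (‖w - 1‖ + ‖w + 1‖) / 2 := by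
  have h : ‖(w - 1) + (w + 1)‖ ≤ ‖w - 1‖ + ‖w + 1‖ := norm_add_le _ _
  rw [show (w - 1) + (w + 1) = 2 * w by ring, norm_mul, RCLike.norm_ofNat] at h
  linarith

theorem segmentGreen_nonneg (w : ℂ) : 0 ≤ segmentGreen w :=
  Real.arcosh_nonneg (one_le_half_norm_sub_one_add_norm_add_one w)

theorem segmentGreen_zero : segmentGreen 0 = 0 := by
  simp [segmentGreen]

theorem continuous_segmentGreen : Continuous segmentGreen :=
  Real.continuousOn_arcosh.comp_continuous (by fun_prop)
    one_le_half_norm_sub_one_add_norm_add_one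

theorem norm_le_cosh_segmentGreen (w : ℂ) : ‖w‖ ≤ Real.cosh (segmentGreen w) := by
  rw [segmentGreen, Real.cosh_arcosh (one_le_half_norm_sub_one_add_norm_add_one w)]
  exact norm_le_half_norm_sub_one_add_norm_add_one w

theorem isBounded_segmentGreen_preimage_Iic (a : ℝ) :
    Bornology.IsBounded (segmentGreen ⁻¹' Iic a) := by
  refine Metric.isBounded_closedBall.subset (t := Metric.closedBall 0 (Real.cosh a))
    fun w hw => mem_closedBall_zero_iff.2 ?_
  exact (norm_le_cosh_segmentGreen w).trans
    (Real.cosh_le_cosh.2 (abs_le_abs_of_nonneg (segmentGreen_nonneg w) hw))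

theorem isCobounded_segmentGreen_preimage_Ioi (a : ℝ) :
    Bornology.IsCobounded (segmentGreen ⁻¹' Ioi a) := by
  rw [← Bornology.isBounded_compl_iff, ← preimage_compl, compl_Ioi]
  exact isBounded_segmentGreen_preimage_Iic a

theorem isProperMap_segmentGreen : IsProperMap segmentGreen := by
  refine isProperMap_iff_isCompact_preimage.2 ⟨continuous_segmentGreen, fun K hK => ?_⟩
  obtain ⟨a, ha⟩ := hK.bddAbove
  exact Metric.isCompact_of_isClosed_isBounded (hK.isClosed.preimage continuous_segmentGreen)
    ((isBounded_segmentGreen_preimage_Iic a).subset (preimage_mono ha))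

theorem cosh_re (ζ : ℂ) : (Complex.cosh ζ).re = Real.cosh ζ.re * Real.cos ζ.im := by
  rw [← Complex.cos_mul_I, Complex.cos_eq]
  simp [← Complex.ofReal_cos, ← Complex.ofReal_cosh, ← Complex.ofReal_sin, ← Complex.ofReal_sinh,
    mul_comm]

theorem cosh_im (ζ : ℂ) : (Complex.cosh ζ).im = Real.sinh ζ.re * Real.sin ζ.im := by
  rw [← Complex.cos_mul_I, Complex.cos_eq]
  simp [← Complex.ofReal_cos, ← Complex.ofReal_cosh, ← Complex.ofReal_sin, ← Complex.ofReal_sinh,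
    mul_comm]

theorem norm_cosh_add_of_sq_eq_one (ζ : ℂ) {ε : ℝ} (hε : ε ^ 2 = 1) :
    ‖Complex.cosh ζ + ε‖ = Real.cosh ζ.re + ε * Real.cos ζ.im := by
  have hnonneg : 0 ≤ Real.cosh ζ.re + ε * Real.cos ζ.im := by
    have habs : |ε * Real.cos ζ.im| ≤ 1 := by
      rw [← sq_le_one_iff_abs_le_one, mul_pow, hε, one_mul]
      exact Real.cos_sq_le_one _
    linarith [Real.one_le_cosh ζ.re, neg_le_of_abs_le habs]
  refine (sq_eq_sq₀ (norm_nonneg _) hnonneg).1 ?_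
  rw [Complex.sq_norm, Complex.normSq_apply, Complex.add_re, Complex.add_im, cosh_re, cosh_im,
    Complex.ofReal_re, Complex.ofReal_im]
  linear_combination -Real.sin ζ.im ^ 2 * Real.cosh_sq ζ.re
    + (Real.cosh ζ.re ^ 2 - 1) * Real.sin_sq_add_cos_sq ζ.im + (1 - Real.cos ζ.im ^ 2) * hε

theorem segmentGreen_cosh (ζ : ℂ) : segmentGreen (Complex.cosh ζ) = |ζ.re| := by
  have hneg := norm_cosh_add_of_sq_eq_one ζ (ε := -1) (by norm_num)
  have hpos := norm_cosh_add_of_sq_eq_one ζ (ε := 1) (by norm_num)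
  push_cast at hneg hpos
  rw [segmentGreen, sub_eq_add_neg, hneg, hpos, ← Real.arcosh_cosh (abs_nonneg ζ.re),
    Real.cosh_abs]
  ring_nf

theorem exists_cosh_eq (w : ℂ) : ∃ ζ : ℂ, ζ.re = segmentGreen w ∧ Complex.cosh ζ = w := by
  obtain ⟨ξ, rfl⟩ := Complex.cos_surjective w
  rw [← Complex.cosh_mul_I, segmentGreen_cosh]
  rcases abs_choice (ξ * Complex.I).re with h | h
  · exact ⟨ξ * Complex.I, h.symm, rfl⟩
  · exact ⟨-(ξ * Complex.I), by rw [h, Complex.neg_re], Complex.cosh_neg _⟩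

theorem segmentGreen_preimage_zero :
    segmentGreen ⁻¹' {0} = (fun x : ℝ => (x : ℂ)) '' Icc (-1 : ℝ) 1 := by
  ext w
  constructor
  · intro hw
    obtain ⟨ζ, hζ, rfl⟩ := exists_cosh_eq w
    have hζI : ζ = ζ.im * Complex.I := Complex.ext (by simpa using hζ.trans hw) (by simp)
    exact ⟨Real.cos ζ.im, Real.cos_mem_Icc _, by rw [hζI, Complex.cosh_mul_I]; simp⟩
  · rintro ⟨x, ⟨hx1, hx2⟩, rfl⟩
    have hsub : ‖(x : ℂ) - 1‖ = 1 - x := by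
      rw [← Complex.ofReal_one, ← Complex.ofReal_sub, Complex.norm_real, Real.norm_eq_abs,
        abs_sub_comm, abs_of_nonneg (by linarith)]
    have hadd : ‖(x : ℂ) + 1‖ = x + 1 := by
      rw [← Complex.ofReal_one, ← Complex.ofReal_add, Complex.norm_real, Real.norm_eq_abs,
        abs_of_nonneg (by linarith)]
    rw [mem_preimage, segmentGreen, hsub, hadd,
      show (1 - x + (x + 1)) / 2 = 1 by ring, Real.arcosh_zero, mem_singleton_iff]

theorem cosh_image_re_preimage (s : Set ℝ) :
    Complex.cosh '' (Complex.re ⁻¹' (s ∩ Ici 0)) = segmentGreen ⁻¹' s := by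
  ext w
  constructor
  · rintro ⟨ζ, ⟨hs, h0⟩, rfl⟩
    rwa [mem_preimage, segmentGreen_cosh, abs_of_nonneg h0]
  · intro hw
    obtain ⟨ζ, hζ, rfl⟩ := exists_cosh_eq w
    exact ⟨ζ, ⟨hζ ▸ hw, hζ ▸ segmentGreen_nonneg _⟩, rfl⟩

theorem convex_re_preimage {s : Set ℝ} (hs : s.OrdConnected) : Convex ℝ (Complex.re ⁻¹' s) :=
  hs.convex.is_linear_preimage Complex.reLm.isLinear

theorem isPreconnected_segmentGreen_preimage {s : Set ℝ} (hs : s.OrdConnected) :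
    IsPreconnected (segmentGreen ⁻¹' s) := by
  rw [← cosh_image_re_preimage]
  exact (convex_re_preimage (hs.inter ordConnected_Ici)).isPreconnected.image _
    Complex.continuous_cosh.continuousOn

theorem segmentGreen_preimage_Iio_subset_closure {c : ℝ} (hc : 0 < c) :
    segmentGreen ⁻¹' Iio c ⊆ closure (segmentGreen ⁻¹' Ioo 0 c) := by
  intro w hw
  obtain ⟨ζ, hζ, rfl⟩ := exists_cosh_eq w
  rw [← cosh_image_re_preimage]
  refine image_closure_subset_closure_image Complex.continuous_cosh (mem_image_of_mem _ ?_)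
  rw [← Complex.isOpenMap_re.preimage_closure_eq_closure_preimage Complex.continuous_re,
    inter_eq_left.2 (Ioo_subset_Ioi_self.trans Ioi_subset_Ici_self), closure_Ioo hc.ne]
  exact ⟨hζ ▸ segmentGreen_nonneg _, hζ ▸ le_of_lt hw⟩

/-! ### Polynomial maps -/

theorem surjective_eval_of_degree_pos {k : Type*} [Field k] [IsAlgClosed k] {T : k[X]}
    (hT : 0 < T.degree) : Function.Surjective fun z => T.eval z :=
  IsAlgClosed.eval_surjective (natDegree_pos_iff_degree_pos.2 hT).ne'

theorem isOpenMap_of_differentiable_of_surjective {f : ℂ → ℂ} (hf : Differentiable ℂ f)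
    (hsurj : Function.Surjective f) : IsOpenMap f := by
  refine (AnalyticOnNhd.is_constant_or_isOpenMap fun z _ => hf.analyticAt z).resolve_left ?_
  rintro ⟨w, hw⟩
  obtain ⟨x, hx⟩ := hsurj (w + 1)
  simp [hw x] at hx

theorem isOpenMap_eval_of_degree_pos {T : ℂ[X]} (hT : 0 < T.degree) :
    IsOpenMap fun z => T.eval z :=
  isOpenMap_of_differentiable_of_surjective T.differentiable (surjective_eval_of_degree_pos hT)

theorem isOpen_image_of_eval_comp_eqOn {𝕜 X : Type*} [NontriviallyNormedField 𝕜] [CompleteSpace 𝕜]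
    [TopologicalSpace X] (P : 𝕜[X]) {f h : X → 𝕜} (hh : IsOpenMap h) {U : Set X} (hU : IsOpen U)
    (hf : ContinuousOn f U) (hPf : ∀ x ∈ U, P.eval (f x) = h x)
    (hP : ∀ x ∈ U, P.derivative.eval (f x) ≠ 0) : IsOpen (f '' U) := by
  refine isOpen_image_of_comp_eqOn P.continuous hh hU hf hPf fun x hx => ?_
  have hequiv := (P.hasStrictDerivAt (f x)).hasStrictFDerivAt_equiv (hP x hx)
  exact ⟨_, (hequiv.toOpenPartialHomeomorph _).open_source.mem_nhds
    hequiv.mem_toOpenPartialHomeomorph_source, (hequiv.toOpenPartialHomeomorph _).injOn⟩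

theorem existsUnique_lift_eval {𝕜 A : Type*} [NontriviallyNormedField 𝕜] [ProperSpace 𝕜]
    [TopologicalSpace A] [SimplyConnectedSpace A] [LocallyPathConnectedSpace A]
    (T : 𝕜[X]) (f : C(A, 𝕜)) (hf : ∀ z, T.derivative.eval z = 0 → T.eval z ∉ range f)
    {a : A} {z : 𝕜} (hz : T.eval z = f a) :
    ∃! g : C(A, 𝕜), g a = z ∧ ∀ b, T.eval (g b) = f b := by
  have hregular : ∀ b, f b ∈ ((fun z => T.eval z) '' {z | T.derivative.eval z = 0})ᶜ := by
    rintro b ⟨w, hw, hwb⟩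
    exact hf w hw ⟨b, hwb.symm⟩
  simpa only [funext_iff, Function.comp_apply] using
    T.isCoveringMapOn_eval.existsUnique_continuousMap_lifts f hz hregular

theorem isPreconnected_compl_closedBall {r : ℝ} (hr : 0 < r) :
    IsPreconnected (Metric.closedBall (0 : ℂ) r)ᶜ := by
  have himage : Complex.exp '' (Complex.re ⁻¹' Ioi (Real.log r)) =
      (Metric.closedBall (0 : ℂ) r)ᶜ := by
    ext z
    constructor
    · rintro ⟨ζ, hζ, rfl⟩
      simpa [Complex.norm_exp] using (Real.log_lt_iff_lt_exp hr).1 hζ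
    · intro hz
      have hrz : r < ‖z‖ := by simpa using hz
      refine ⟨Complex.log z, ?_, Complex.exp_log (norm_pos_iff.1 (hr.trans hrz))⟩
      simpa [Complex.log_re] using Real.log_lt_log hr hrz
  rw [← himage]
  exact (convex_re_preimage ordConnected_Ioi).isPreconnected.image _
    Complex.continuous_exp.continuousOn

theorem isPreconnected_eval_preimage_of_isCobounded {T : ℂ[X]} (hT : 0 < T.degree) {E : Set ℂ}
    (hEo : IsOpen E) (hE : IsPreconnected E) (hEb : Bornology.IsCobounded E) :
    IsPreconnected ((fun z => T.eval z) ⁻¹' E) := by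
  have hproper := T.isProperMap_eval hT
  have hcompact : IsCompact ((fun z => T.eval z) ⁻¹' Eᶜ) := hproper.isCompact_preimage
    (Metric.isCompact_of_isClosed_isBounded hEo.isClosed_compl hEb.compl)
  obtain ⟨r, hr, hball⟩ := hcompact.isBounded.subset_closedBall_lt 0 0
  refine isPreconnected_preimage_of_isProperMap hproper (isOpenMap_eval_of_degree_pos hT)
    hEo hE (isPreconnected_compl_closedBall hr) (compl_subset_comm.1 hball) fun hsub => ?_
  rw [compl_compl] at hsub
  refine NormedSpace.unbounded_univ ℂ ℂ ?_
  rw [← union_compl_self E]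
  exact (((isCompact_closedBall 0 r).image T.continuous).isBounded.subset hsub).union hEb.compl

/-! ### Critical values lie in the segment -/

theorem exists_continuousOn_exp_eq_div {G : Set ℂ} (hGo : IsOpen G) (hG : IsPreconnected G)
    {a b : ℂ} (ha : a ∈ G) (hb : b ∈ G) :
    ∃ L : ℂ → ℂ, ContinuousOn L Gᶜ ∧ ∀ z ∈ Gᶜ, Complex.exp (L z) = (z - b) / (z - a) := by
  have hne : ∀ {c z : ℂ}, c ∈ G → z ∈ Gᶜ → z - c ≠ 0 := fun hc hz =>
    sub_ne_zero.2 fun h => hz (h ▸ hc)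
  refine hG.induction₂ (fun a b => ∃ L : ℂ → ℂ, ContinuousOn L Gᶜ ∧
    ∀ z ∈ Gᶜ, Complex.exp (L z) = (z - b) / (z - a)) (fun a ha => ?_) ?_ ?_ ha hb
  · obtain ⟨r, hr, hball⟩ := Metric.isOpen_iff.1 hGo a ha
    filter_upwards [mem_nhdsWithin_of_mem_nhds (Metric.ball_mem_nhds a hr)] with b hb
    have hslit : ∀ z ∈ Gᶜ, 1 + (a - b) / (z - a) ∈ Complex.slitPlane := fun z hz => by
      refine Complex.mem_slitPlane_of_norm_lt_one ?_
      rw [norm_div, div_lt_one (norm_pos_iff.2 (hne ha hz))]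
      have hrz : r ≤ ‖z - a‖ := by
        rw [← dist_eq_norm]
        exact not_lt.1 fun h => hz (hball h)
      rw [← dist_eq_norm, dist_comm]
      exact (Metric.mem_ball.1 hb).trans_le hrz
    refine ⟨fun z => Complex.log (1 + (a - b) / (z - a)), ?_, fun z hz => ?_⟩
    · refine ContinuousOn.clog ?_ hslit
      exact continuousOn_const.add (continuousOn_const.div (by fun_prop) fun z hz => hne ha hz)
    · rw [Complex.exp_log (Complex.slitPlane_ne_zero (hslit z hz))]
      field_simp [hne ha hz]
      ring
  · rintro a b c - hb - ⟨L, hL, hLe⟩ ⟨M, hM, hMe⟩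
    refine ⟨fun z => M z + L z, hM.add hL, fun z hz => ?_⟩
    rw [Complex.exp_add, hLe z hz, hMe z hz, div_mul_div_cancel₀ (hne hb hz)]
  · rintro a b - - ⟨L, hL, hLe⟩
    exact ⟨fun z => -L z, hL.neg, fun z hz => by rw [Complex.exp_neg, hLe z hz, inv_div]⟩

theorem exists_continuousOn_prod_sub_eq_pow_mul_exp {G : Set ℂ} (hGo : IsOpen G)
    (hG : IsPreconnected G) {a : ℂ} (ha : a ∈ G) (s : Multiset ℂ) (hs : ∀ b ∈ s, b ∈ G) :
    ∃ L : ℂ → ℂ, ContinuousOn L Gᶜ ∧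
      ∀ z ∈ Gᶜ, (s.map (z - ·)).prod = (z - a) ^ s.card * Complex.exp (L z) := by
  induction s using Multiset.induction with
  | empty => exact ⟨0, continuousOn_const, by simp⟩
  | cons b s ih =>
    obtain ⟨M, hM, hMe⟩ := exists_continuousOn_exp_eq_div hGo hG ha (hs b (s.mem_cons_self b))
    obtain ⟨L, hL, hLe⟩ := ih fun c hc => hs c (Multiset.mem_cons_of_mem hc)
    refine ⟨fun z => M z + L z, hM.add hL, fun z hz => ?_⟩
    have hza : z - a ≠ 0 := sub_ne_zero.2 fun h => hz (h ▸ ha)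
    rw [Multiset.map_cons, Multiset.prod_cons, Multiset.card_cons, hLe z hz, Complex.exp_add,
      hMe z hz]
    field_simp
    ring

theorem exists_continuousOn_pow_eq_eval {T : ℂ[X]} (hT : 0 < T.degree) {G : Set ℂ}
    (hGo : IsOpen G) (hG : IsPreconnected G) (hroots : ∀ z, T.eval z = 0 → z ∈ G) :
    ∃ S : ℂ → ℂ, ContinuousOn S Gᶜ ∧ ∀ z ∈ Gᶜ, S z ^ T.natDegree = T.eval z := by
  have hT0 : T ≠ 0 := ne_zero_of_degree_gt hT
  have hn : (T.natDegree : ℂ) ≠ 0 := Nat.cast_ne_zero.2 (natDegree_pos_iff_degree_pos.2 hT).ne'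
  obtain ⟨a, ha⟩ := surjective_eval_of_degree_pos hT 0
  obtain ⟨L, hL, hLe⟩ := exists_continuousOn_prod_sub_eq_pow_mul_exp hGo hG (hroots a ha) T.roots
    fun b hb => hroots b (isRoot_of_mem_roots hb)
  have hsplits := IsAlgClosed.splits T
  refine ⟨fun z => (z - a) * Complex.exp ((L z + Complex.log T.leadingCoeff) / T.natDegree),
    by fun_prop, fun z hz => ?_⟩
  rw [mul_pow, ← Complex.exp_nat_mul, mul_div_cancel₀ _ hn, Complex.exp_add,
    Complex.exp_log (leadingCoeff_ne_zero.2 hT0), ← mul_assoc,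
    hsplits.natDegree_eq_card_roots, ← hLe z hz, hsplits.eval_eq_prod_roots, mul_comm]

theorem image_eq_npow_preimage {T : ℂ[X]} (hT : 0 < T.degree) {E : Set ℂ} (hEo : IsOpen E)
    (hE : IsPreconnected E) (hEb : Bornology.IsCobounded E) (h0 : 0 ∉ E) {S : ℂ → ℂ}
    (hS : ContinuousOn S ((fun z => T.eval z) ⁻¹' E))
    (hST : ∀ z, T.eval z ∈ E → S z ^ T.natDegree = T.eval z) :
    S '' ((fun z => T.eval z) ⁻¹' E) = (fun u => u ^ T.natDegree) ⁻¹' E := by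
  have hn : T.natDegree ≠ 0 := (natDegree_pos_iff_degree_pos.2 hT).ne'
  have hXn : 0 < (X ^ T.natDegree : ℂ[X]).degree := by
    rw [degree_X_pow]
    exact_mod_cast Nat.pos_of_ne_zero hn
  have hU : IsOpen ((fun z => T.eval z) ⁻¹' E) := hEo.preimage T.continuous
  have hpreim : IsPreconnected ((fun u : ℂ => u ^ T.natDegree) ⁻¹' E) := by
    simpa only [eval_pow, eval_X] using
      isPreconnected_eval_preimage_of_isCobounded hXn hEo hE hEb
  have himage : IsOpen (S '' ((fun z => T.eval z) ⁻¹' E)) := by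
    refine isOpen_image_of_eval_comp_eqOn (X ^ T.natDegree) (isOpenMap_eval_of_degree_pos hT) hU hS
      (fun z hz => by simpa only [eval_pow, eval_X] using hST z hz) fun z hz h => ?_
    have hSz : S z = 0 := by
      simp only [derivative_X_pow, eval_mul, eval_pow, eval_X, eval_C, mul_eq_zero,
        Nat.cast_eq_zero, hn, false_or] at h
      exact eq_zero_of_pow_eq_zero h
    have hTz : T.eval z = 0 := by rw [← hST z hz, hSz, zero_pow hn]
    exact h0 (hTz ▸ hz)
  have hnonempty : E.Nonempty := nonempty_of_mem hEb
  exact image_eq_preimage_of_isProperMap (T.isProperMap_eval hT) (continuous_pow _) hpreim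
    (hnonempty.preimage (surjective_eval_of_degree_pos hT)) Subset.rfl inter_subset_right
    (fun z hz => hS.continuousAt (hU.mem_nhds hz)) hST himage

theorem separable_sub_C_of_nthRoots_subset_image {T : ℂ[X]} (hT : 0 < T.degree) {w : ℂ} (hw : w ≠ 0)
    (S : ℂ → ℂ) (h : ∀ u, u ^ T.natDegree = w → ∃ z, T.eval z = w ∧ S z = u) :
    (T - C w).Separable := by
  have hn : T.natDegree ≠ 0 := (natDegree_pos_iff_degree_pos.2 hT).ne'
  have hTw : T - C w ≠ 0 := ne_zero_of_degree_gt ((degree_sub_C hT).symm ▸ hT)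
  have hζ := Complex.isPrimitiveRoot_exp _ hn
  have hcard : (nthRoots T.natDegree w).card = T.natDegree := by
    rw [hζ.card_nthRoots, if_pos (IsAlgClosed.exists_pow_nat_eq w (Nat.pos_of_ne_zero hn))]
  have hsub : (nthRoots T.natDegree w).toFinset ⊆ (T - C w).roots.toFinset.image S := by
    intro u hu
    obtain ⟨z, hz, rfl⟩ := h u
      ((mem_nthRoots (Nat.pos_of_ne_zero hn)).1 (Multiset.mem_toFinset.1 hu))
    exact Finset.mem_image_of_mem S (Multiset.mem_toFinset.2 ((mem_roots hTw).2 (by simp [hz])))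
  refine (nodup_roots_iff_of_splits hTw (IsAlgClosed.splits _)).1
    (Multiset.toFinset_card_eq_card_iff_nodup.1 ((Multiset.toFinset_card_le _).antisymm ?_))
  calc (T - C w).roots.card ≤ T.natDegree := natDegree_sub_C (p := T) (a := w) ▸ card_roots' _
    _ = (nthRoots T.natDegree w).toFinset.card := by
      rw [Multiset.toFinset_card_of_nodup (hζ.nthRoots_nodup hw), hcard]
    _ ≤ (T - C w).roots.toFinset.card := (Finset.card_le_card hsub).trans Finset.card_image_le

theorem derivative_eval_ne_zero_of_roots_mem {T : ℂ[X]} (hT : 0 < T.degree) {E G : Set ℂ}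
    (hEo : IsOpen E) (hE : IsPreconnected E) (hEb : Bornology.IsCobounded E) (hGo : IsOpen G)
    (hG : IsPreconnected G) (hroots : ∀ z, T.eval z = 0 → z ∈ G)
    (hGE : Disjoint G ((fun z => T.eval z) ⁻¹' E)) {z : ℂ} (hz : T.eval z ∈ E) :
    T.derivative.eval z ≠ 0 := by
  obtain ⟨S, hS, hST⟩ := exists_continuousOn_pow_eq_eval hT hGo hG hroots
  have hEG : (fun z => T.eval z) ⁻¹' E ⊆ Gᶜ := hGE.symm.subset_compl_right
  have h0 : (0 : ℂ) ∉ E := fun h0 => by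
    obtain ⟨a, ha : T.eval a = 0⟩ := surjective_eval_of_degree_pos hT 0
    exact hEG (show T.eval a ∈ E from ha.symm ▸ h0) (hroots a ha)
  have himage := image_eq_npow_preimage hT hEo hE hEb h0 (hS.mono hEG) fun z hz => hST z (hEG hz)
  have hsep : (T - C (T.eval z)).Separable := by
    refine separable_sub_C_of_nthRoots_subset_image hT (ne_of_mem_of_not_mem hz h0) S fun u hu => ?_
    obtain ⟨x, hx, rfl⟩ := himage.superset (show u ^ T.natDegree ∈ E from hu.symm ▸ hz)
    exact ⟨x, (hST x (hEG hx)).symm.trans hu, rfl⟩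
  simpa using hsep.aeval_derivative_ne_zero (x := z) (by simp)

theorem eval_mem_of_isPreconnected {T : ℂ[X]} (hT : 0 < T.degree)
    (hK : IsPreconnected ((fun z => T.eval z) ⁻¹' (segmentGreen ⁻¹' {0}))) {z : ℂ}
    (hz : T.derivative.eval z = 0) : T.eval z ∈ segmentGreen ⁻¹' {0} := by
  by_contra hzK
  set c := segmentGreen (T.eval z)
  have hc : 0 < c := (segmentGreen_nonneg _).lt_of_ne' hzK
  have hlt : IsOpen (segmentGreen ⁻¹' Iio (c / 2)) := isOpen_Iio.preimage continuous_segmentGreen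
  have hgt : IsOpen (segmentGreen ⁻¹' Ioi (c / 2)) := isOpen_Ioi.preimage continuous_segmentGreen
  have hsublevel : IsPreconnected ((fun z => T.eval z) ⁻¹' (segmentGreen ⁻¹' Iio (c / 2))) := by
    refine isPreconnected_preimage_of_isProperMap (T.isProperMap_eval hT)
      (isOpenMap_eval_of_degree_pos hT) hlt
      (isPreconnected_segmentGreen_preimage ordConnected_Iio) hK
      (preimage_mono (preimage_mono (singleton_subset_iff.2 (half_pos hc)))) fun hsub => ?_
    have h0 : segmentGreen 0 < c / 2 := segmentGreen_zero.symm ▸ half_pos hc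
    obtain ⟨a, ha, ha0⟩ := hsub h0
    exact ha ((congrArg segmentGreen ha0).trans segmentGreen_zero)
  refine derivative_eval_ne_zero_of_roots_mem hT hgt
    (isPreconnected_segmentGreen_preimage ordConnected_Ioi)
    (isCobounded_segmentGreen_preimage_Ioi _) (hlt.preimage T.continuous) hsublevel
    (fun a ha => ?_) ?_ (half_lt_self hc) hz
  · simpa [ha, segmentGreen_zero] using hc
  · exact (((Iio_disjoint_Ici le_rfl).mono_right Ioi_subset_Ici_self).preimage _).preimage _

/-! ### Lifting the hyperbolic cosine through a polynomial -/

/-- The open right half-plane; `cosh` maps it onto `ℂ ∖ [-1, 1]` as a universal covering. -/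
abbrev RightHalfPlane : Type := Complex.re ⁻¹' Ioi 0

/-- The hyperbolic cosine on the open right half-plane, the map to be lifted through `T`. -/
noncomputable def halfPlaneCosh : C(RightHalfPlane, ℂ) :=
  ⟨fun ζ => Complex.cosh ζ, by fun_prop⟩

theorem isOpen_re_preimage_Ioi : IsOpen (Complex.re ⁻¹' Ioi 0) :=
  isOpen_Ioi.preimage Complex.continuous_re

instance : ContractibleSpace RightHalfPlane :=
  (convex_re_preimage ordConnected_Ioi).contractibleSpace ⟨1, by simp⟩

instance : LocallyPathConnectedSpace RightHalfPlane :=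
  isOpen_re_preimage_Ioi.locallyPathConnectedSpace

theorem isOpenMap_halfPlaneCosh : IsOpenMap halfPlaneCosh :=
  (isOpenMap_of_differentiable_of_surjective Complex.differentiable_cosh fun w =>
    (exists_cosh_eq w).imp fun _ => And.right).comp isOpen_re_preimage_Ioi.isOpenMap_subtype_val

theorem segmentGreen_halfPlaneCosh (ζ : RightHalfPlane) :
    segmentGreen (halfPlaneCosh ζ) = (ζ : ℂ).re :=
  (segmentGreen_cosh ζ).trans (abs_of_pos ζ.2)

theorem range_halfPlaneCosh : range halfPlaneCosh = segmentGreen ⁻¹' Ioi 0 := by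
  ext w
  constructor
  · rintro ⟨ζ, rfl⟩
    rw [mem_preimage, segmentGreen_halfPlaneCosh]
    exact ζ.2
  · intro hw
    obtain ⟨ζ, hζ, hζw⟩ := exists_cosh_eq w
    exact ⟨⟨ζ, by rw [mem_preimage, hζ]; exact hw⟩, hζw⟩

/-- Translation of the right half-plane by `2πik`, a deck transformation of `halfPlaneCosh`. -/
noncomputable def halfPlaneShift (k : ℤ) : C(RightHalfPlane, RightHalfPlane) :=
  ⟨fun ζ => ⟨ζ + k * (2 * Real.pi * Complex.I), by simpa using mem_preimage.1 ζ.2⟩, by fun_prop⟩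

theorem halfPlaneCosh_shift (k : ℤ) (ζ : RightHalfPlane) :
    halfPlaneCosh (halfPlaneShift k ζ) = halfPlaneCosh ζ :=
  Complex.cosh_periodic.int_mul k ζ

theorem exists_halfPlaneShift_eq {ζ ξ : RightHalfPlane} (h : halfPlaneCosh ζ = halfPlaneCosh ξ) :
    ∃ k, halfPlaneShift k ζ = ξ := by
  have hcos : Complex.cos (ζ * Complex.I) = Complex.cos (ξ * Complex.I) := by
    rwa [Complex.cos_mul_I, Complex.cos_mul_I]
  obtain ⟨k, hk | hk⟩ := Complex.cos_eq_cos_iff.1 hcos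
  · refine ⟨-k, Subtype.ext (mul_right_cancel₀ Complex.I_ne_zero ?_)⟩
    simp only [halfPlaneShift, ContinuousMap.coe_mk, Int.cast_neg]
    linear_combination -hk - 2 * k * Real.pi * Complex.I_sq
  · have hre : (ξ : ℂ).re = -(ζ : ℂ).re := by simpa using congrArg Complex.im hk
    have hζ : 0 < (ζ : ℂ).re := ζ.2
    have hξ : 0 < (ξ : ℂ).re := ξ.2
    linarith

theorem range_lift_halfPlaneCosh {T : ℂ[X]} (hT : 0 < T.degree)
    (hcrit : ∀ z, T.derivative.eval z = 0 → T.eval z ∉ range halfPlaneCosh)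
    {g : C(RightHalfPlane, ℂ)} (hg : ∀ ζ, T.eval (g ζ) = halfPlaneCosh ζ) :
    range g = (fun z => T.eval z) ⁻¹' range halfPlaneCosh := by
  have hopen : ∀ h : C(RightHalfPlane, ℂ), (∀ ζ, T.eval (h ζ) = halfPlaneCosh ζ) →
      IsOpen (range h) := fun h hh => by
    rw [← image_univ]
    exact isOpen_image_of_eval_comp_eqOn T isOpenMap_halfPlaneCosh isOpen_univ
      h.continuous.continuousOn (fun ζ _ => hh ζ) fun ζ _ h0 => hcrit _ h0 ⟨ζ, (hh ζ).symm⟩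
  have hsub : range g ⊆ (fun z => T.eval z) ⁻¹' range halfPlaneCosh := by
    rintro _ ⟨ζ, rfl⟩
    exact ⟨ζ, (hg ζ).symm⟩
  have hpre : IsPreconnected ((fun z => T.eval z) ⁻¹' range halfPlaneCosh) := by
    rw [range_halfPlaneCosh]
    exact isPreconnected_eval_preimage_of_isCobounded hT
      (isOpen_Ioi.preimage continuous_segmentGreen)
      (isPreconnected_segmentGreen_preimage ordConnected_Ioi)
      (isCobounded_segmentGreen_preimage_Ioi 0)
  refine hsub.antisymm (hpre.subset_of_closure_inter_subset (hopen g hg)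
    ((range_nonempty g).mono fun z hz => ⟨hsub hz, hz⟩) ?_)
  rintro z ⟨hz, ζ, hζ⟩
  obtain ⟨h, ⟨hhζ, hh⟩, -⟩ := existsUnique_lift_eval T halfPlaneCosh hcrit hζ.symm
  obtain ⟨_, ⟨ζ₁, rfl⟩, ζ₂, hζ₂⟩ := mem_closure_iff.1 hz (range h) (hopen h hh) ⟨ζ, hhζ⟩
  obtain ⟨k, rfl⟩ := exists_halfPlaneShift_eq (ζ := ζ₁) (ξ := ζ₂) (by rw [← hh, ← hg, hζ₂])
  have hdeck : g.comp (halfPlaneShift k) = h :=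
    (existsUnique_lift_eval T halfPlaneCosh hcrit (hh ζ₁)).unique
      ⟨hζ₂, fun ξ => (hg _).trans (halfPlaneCosh_shift k ξ)⟩ ⟨rfl, hh⟩
  exact ⟨halfPlaneShift k ζ, by rw [← hhζ, ← hdeck, ContinuousMap.comp_apply]⟩

theorem isPreconnected_eval_preimage_Ioo {T : ℂ[X]} (hT : 0 < T.degree)
    (hcrit : ∀ z, T.derivative.eval z = 0 → T.eval z ∉ range halfPlaneCosh) (c : ℝ) :
    IsPreconnected ((fun z => T.eval z) ⁻¹' (segmentGreen ⁻¹' Ioo 0 c)) := by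
  obtain ⟨z, hz⟩ := surjective_eval_of_degree_pos hT (halfPlaneCosh ⟨1, by simp⟩)
  obtain ⟨g, ⟨-, hg⟩, -⟩ := existsUnique_lift_eval T halfPlaneCosh hcrit hz
  set A := (fun z => T.eval z) ⁻¹' (segmentGreen ⁻¹' Ioo 0 c)
  have hA : A ⊆ range g := by
    rw [range_lift_halfPlaneCosh hT hcrit hg, range_halfPlaneCosh]
    exact preimage_mono (preimage_mono Ioo_subset_Ioi_self)
  have hstrip : Subtype.val '' (g ⁻¹' A) = Complex.re ⁻¹' Ioo 0 c := by
    ext ζ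
    constructor
    · rintro ⟨ζ, hζ, rfl⟩
      rwa [mem_preimage, ← segmentGreen_halfPlaneCosh, ← hg]
    · intro hζ
      refine ⟨⟨ζ, hζ.1⟩, ?_, rfl⟩
      rwa [mem_preimage, mem_preimage, hg, mem_preimage, segmentGreen_halfPlaneCosh]
  rw [← image_preimage_eq_of_subset hA]
  refine IsPreconnected.image ?_ _ g.continuous.continuousOn
  rw [← IsInducing.subtypeVal.isPreconnected_image, hstrip]
  exact (convex_re_preimage ordConnected_Ioo).isPreconnected

theorem isPreconnected_eval_preimage_zero {T : ℂ[X]} (hT : 0 < T.degree)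
    (hcrit : ∀ z, T.derivative.eval z = 0 → T.eval z ∈ segmentGreen ⁻¹' {0}) :
    IsPreconnected ((fun z => T.eval z) ⁻¹' (segmentGreen ⁻¹' {0})) := by
  have hcrit' : ∀ z, T.derivative.eval z = 0 → T.eval z ∉ range halfPlaneCosh := fun z hz => by
    rw [range_halfPlaneCosh, mem_preimage, hcrit z hz]
    exact self_notMem_Ioi
  refine isPreconnected_fiber_of_isProperMap (isProperMap_segmentGreen.comp (T.isProperMap_eval hT))
    Metric.nhds_basis_ball fun c hc => ?_
  have hball : segmentGreen ⁻¹' Metric.ball 0 c = segmentGreen ⁻¹' Iio c := by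
    ext w
    simp [abs_of_nonneg (segmentGreen_nonneg w)]
  rw [preimage_comp, hball]
  refine (isPreconnected_eval_preimage_Ioo hT hcrit' c).subset_closure
    (preimage_mono (preimage_mono Ioo_subset_Iio_self)) ?_
  rw [← (isOpenMap_eval_of_degree_pos hT).preimage_closure_eq_closure_preimage T.continuous]
  exact preimage_mono (segmentGreen_preimage_Iio_subset_closure hc)

theorem isConnected_eval_preimage_iff_of_degree_eq_zero {R : Type*} [CommRing R]
    [TopologicalSpace R] [ConnectedSpace R] {T : R[X]} (hT : T.degree = 0) (K : Set R) :
    IsConnected ((fun z => T.eval z) ⁻¹' K) ↔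
      {z | T.derivative.eval z = 0} ⊆ (fun z => T.eval z) ⁻¹' K := by
  rw [eq_C_of_degree_eq_zero hT]
  by_cases hK : T.coeff 0 ∈ K
  · simpa [preimage_const_of_mem hK] using isConnected_univ
  · simp [preimage_const_of_notMem hK, IsConnected, univ_nonempty.ne_empty]

theorem theorem4 (n : ℕ) (T : Polynomial ℂ) (hT : T.degree = (n : WithBot ℕ)) :
    IsConnected ((fun z : ℂ => T.eval z) ⁻¹' ((fun x : ℝ => (x : ℂ)) '' Set.Icc (-1 : ℝ) 1)) ↔
      {z : ℂ | T.derivative.eval z = 0} ⊆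
        (fun z : ℂ => T.eval z) ⁻¹' ((fun x : ℝ => (x : ℂ)) '' Set.Icc (-1 : ℝ) 1) := by
  rw [← segmentGreen_preimage_zero]
  rcases n.eq_zero_or_pos with rfl | hn
  · exact isConnected_eval_preimage_iff_of_degree_eq_zero hT _
  have hdeg : 0 < T.degree := by
    rw [hT]
    exact_mod_cast hn
  constructor
  · exact fun hK z hz => eval_mem_of_isPreconnected hdeg hK.isPreconnected hz
  · refine fun hcrit => ⟨?_, isPreconnected_eval_preimage_zero hdeg fun z hz => hcrit hz⟩
    have h0 : (segmentGreen ⁻¹' {0}).Nonempty := ⟨0, segmentGreen_zero⟩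
    exact h0.preimage (surjective_eval_of_degree_pos hdeg)
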